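/- Let $k$ be a field of characteristic $0$, let $n\ge 10$, let $c_1,\dots,c_n$ be independent indeterminates over $k$, put $K=k(c_1,\dots,c_n)$, and let $x_1,\dots,x_n$ be the roots, in an algebraic closure $\overline K$ of $K$, of the general equation of degree $n$, $$x^n+c_1x^{n-1}+\cdots+c_n=0 .$$ Then there are a finite tower of fields $K=F_0\subseteq F_1\subseteq\cdots\subseteq F_r=F\subseteq\overline K$, where each $F_{i+1}=F_i(\theta_i)$ is obtained by adjoining one root $\theta_i\in\overline K$ of a polynomial of degree $2$, $3$ or $4$ with coefficients in $F_i$, and elements $a_0,\dots,a_{n-1}\in F$ such that, with $$y_i=a_0+a_1x_i+\cdots+a_{n-1}x_i^{n-1}\qquad(1\le i\le n),$$ the transformed equation $\prod_{i=1}^n(y-y_i)=0$ has the form $$y^n+C_5y^{n-5}+C_6y^{n-6}+\cdots+C_n=0,\qquad C_5,\dots,C_n\in F .$$ Moreover, the transformation is a (non-degenerate) Tschirnhaus transformation, that is, it is invertible over $F$: there are $b_0,\dots,b_{n-1}\in F$ with $x_i=b_0+b_1y_i+\cdots+b_{n-1}y_i^{n-1}$ for all $i$. -/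

import Mathlib

open Polynomial IntermediateField

noncomputable section

/-- The field `k(c_1, …, c_n)` of rational functions in `n` independent indeterminates. -/
abbrev CoeffField (k : Type*) [Field k] (n : ℕ) : Type _ :=
  FractionRing (MvPolynomial (Fin n) k)

/-- The indeterminate coefficient; indices are shifted by one, so `genCoeff k n i` is `c_{i+1}`. -/
def genCoeff (k : Type*) [Field k] (n : ℕ) (i : Fin n) : CoeffField k n :=
  algebraMap (MvPolynomial (Fin n) k) (CoeffField k n) (MvPolynomial.X i)

/-- The general polynomial `x^n + c_1 x^{n-1} + ⋯ + c_n` of degree `n`. -/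
def generalPoly (k : Type*) [Field k] (n : ℕ) : (CoeffField k n)[X] :=
  X ^ n + ∑ i : Fin n, C (genCoeff k n i) * X ^ (n - (i.val + 1))

/-- The value `a_0 + a_1 x + ⋯ + a_{n-1} x^{n-1}`. -/
def tschirnhausValue {L : Type*} [Field L] {n : ℕ} (a : Fin n → L) (x : L) : L :=
  ∑ j : Fin n, a j * x ^ (j : ℕ)

/-- The transformed polynomial: if `x_1, …, x_n` are the roots of `f` in `L`, with multiplicity,
it is the product of the `Y - y_i`, where `y_i = a_0 + a_1 x_i + ⋯ + a_{n-1} x_i^{n-1}`. -/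
def tschirnhausTransform {K L : Type*} [Field K] [Field L] [Algebra K L] {n : ℕ}
    (f : K[X]) (a : Fin n → L) : L[X] :=
  ((f.aroots L).map fun x => X - C (tschirnhausValue a x)).prod

/-- `F` is obtained from `K` by finitely many successive adjunctions, each of one root `θ` of a
quadratic, cubic or quartic polynomial with coefficients in the field reached so far. -/
inductive IsQuarticTower {K L : Type*} [Field K] [Field L] [Algebra K L] :
    IntermediateField K L → Prop
  | base : IsQuarticTower ⊥
  | step (F : IntermediateField K L) (p : F[X]) (θ : L) (hF : IsQuarticTower F)
      (hdeg : p.natDegree = 2 ∨ p.natDegree = 3 ∨ p.natDegree = 4) (hroot : aeval θ p = 0) :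
      IsQuarticTower (restrictScalars K F⟮θ⟯)

end

/-! Let `t u` be the sum of the values of a polynomial `u` at the roots. By Newton's identities the
first four coefficients of the transformed equation vanish once `t (u ^ m) = 0` for `m = 1, 2, 3,
4`, so a nonzero common zero `u` of degree `< n` is wanted. Over `quarticClosure`, where all
quadratics, cubics and quartics have roots, dimension 10 suffices
(`exists_common_zero_power_forms`): a line is found on which the linear, quadratic and cubic forms
vanish identically, and a single quartic equation is solved on that line. The finitely many
coefficients of `u` already lie in one tower `F`.

Invertibility is Galois-theoretic. Steps of degree at most 4 cannot destroy an automorphism inducing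
a 5-cycle on the roots (`IsQuarticTower.exists_algEquiv`). A coincidence `y_i = y_j` is therefore
transported by 5-cycles to every other index; all values are then equal, hence zero as their sum is
zero, and `u` has more roots than its degree allows (`injective_aeval_of_sum_eq_zero`). As the
values are distinct, Lagrange interpolation inverts the transformation, and its coefficients are
Galois-invariant over `F`. -/

/-! ### Common zeros of forms over a field with roots in degrees 2, 3 and 4. -/

theorem le_finrank_inf_ker {k V : Type*} [Field k] [AddCommGroup V] [Module k V]
    (W : Submodule k V) (l : V →ₗ[k] k) {d : ℕ} (h : d + 1 ≤ Module.finrank k W) :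
    d ≤ Module.finrank k (W ⊓ LinearMap.ker l : Submodule k V) := by
  -- `finrank` is 0 in infinite dimension, so a positive value gives finiteness of `W` inside an
  -- arbitrary `V`, such as a polynomial ring.
  have : Module.Finite k W := Module.finite_of_finrank_pos (by omega)
  have e : (LinearMap.ker (l.comp W.subtype)).map W.subtype = W ⊓ LinearMap.ker l := by
    ext x
    simp [and_comm]
  have h1 := LinearMap.finrank_range_add_finrank_ker (l.comp W.subtype)
  have h2 : Module.finrank k (LinearMap.range (l.comp W.subtype)) ≤ 1 := by
    simpa using Submodule.finrank_le (LinearMap.range (l.comp W.subtype))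
  rw [← e, Submodule.finrank_map_subtype_eq]
  omega

theorem Submodule.exists_mem_ne_zero_of_one_le_finrank {k V : Type*} [Field k] [AddCommGroup V]
    [Module k V] (W : Submodule k V) (h : 1 ≤ Module.finrank k W) : ∃ w ∈ W, w ≠ 0 := by
  refine W.exists_mem_ne_zero_of_ne_bot ?_
  rintro rfl
  simp at h

theorem exists_functional_eq_one {k V : Type*} [Field k] [AddCommGroup V] [Module k V]
    {w : V} (hw : w ≠ 0) : ∃ l : V →ₗ[k] k, l w = 1 := by
  obtain ⟨f, hf⟩ := Module.Projective.exists_dual_ne_zero k hw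
  exact ⟨(f w)⁻¹ • f, by simp [hf]⟩

/-- Every polynomial of degree `2`, `3` or `4` over the field has a root in it. -/
def HasQuarticRoots (k : Type*) [Field k] : Prop :=
  ∀ p : k[X], (p.natDegree = 2 ∨ p.natDegree = 3 ∨ p.natDegree = 4) → ∃ r, p.eval r = 0

section PowerForms

variable {k R : Type*} [Field k] [CommRing R] [Algebra k R]

/-- Either `z` is itself a zero, or `t ((w + r z) ^ m)` is a polynomial in `r` of exact degree `m`
with leading coefficient `t (z ^ m)`. The functional `l` certifies that `w + r z` is nonzero. -/
theorem exists_zero_on_line (hk : HasQuarticRoots k) (t l : R →ₗ[k] k) {w z : R}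
    (hw : l w = 1) (hz : l z = 0) (hz0 : z ≠ 0) {m : ℕ} (hm : m = 2 ∨ m = 3 ∨ m = 4) :
    ∃ a b : k, a • w + b • z ≠ 0 ∧ t ((a • w + b • z) ^ m) = 0 := by
  by_cases h : t (z ^ m) = 0
  · exact ⟨0, 1, by simpa using hz0, by simpa using h⟩
  set p : k[X] := ∑ j ∈ Finset.range (m + 1), C (t (z ^ j * w ^ (m - j)) * m.choose j) * X ^ j
    with hp
  have hdeg : p.natDegree = m := by
    refine natDegree_eq_of_le_of_coeff_ne_zero ?_ ?_
    · exact natDegree_sum_le_of_forall_le _ _ fun j hj =>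
        (natDegree_C_mul_X_pow_le _ _).trans (Nat.lt_succ_iff.mp (Finset.mem_range.mp hj))
    · rw [hp, finsetSum_coeff, Finset.sum_eq_single m]
      · simpa using h
      · intro j _ hj
        rw [coeff_C_mul_X_pow, if_neg hj.symm]
      · simp
  obtain ⟨r, hr⟩ := hk p (by rwa [hdeg])
  refine ⟨1, r, fun h0 => ?_, ?_⟩
  · simpa [hw, hz] using congrArg l h0
  · rw [one_smul, add_comm, add_pow, map_sum, ← hr, hp, eval_finsetSum]
    refine Finset.sum_congr rfl fun j _ => ?_
    have : (r • z) ^ j * w ^ (m - j) * (m.choose j : R)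
        = (r ^ j * (m.choose j : k)) • (z ^ j * w ^ (m - j)) := by
      rw [_root_.smul_pow, mul_smul, Algebra.smul_def (m.choose j : k), map_natCast, smul_mul_assoc,
        smul_mul_assoc, mul_comm (m.choose j : R)]
    rw [this, map_smul, smul_eq_mul]
    simp
    ring

/-- A pencil of quadratic forms on a space of dimension at least three has a degenerate member. -/
theorem exists_degenerate_in_pencil (hk : HasQuarticRoots k) (t₁ t₂ : R →ₗ[k] k) {e : Fin 3 → R}
    (he : LinearIndependent k e) :
    ∃ a b : k, (a ≠ 0 ∨ b ≠ 0) ∧ ∃ w ∈ Submodule.span k (Set.range e), w ≠ 0 ∧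
      ∀ v ∈ Submodule.span k (Set.range e), (a • t₁ + b • t₂) (w * v) = 0 := by
  let M (t : R →ₗ[k] k) : Matrix (Fin 3) (Fin 3) k := Matrix.of fun i j => t (e i * e j)
  have key (t : R →ₗ[k] k) (h : (M t).det = 0) : ∃ w ∈ Submodule.span k (Set.range e), w ≠ 0 ∧
      ∀ v ∈ Submodule.span k (Set.range e), t (w * v) = 0 := by
    obtain ⟨c, hc, hM⟩ := Matrix.exists_mulVec_eq_zero_iff.mpr h
    refine ⟨∑ i, c i • e i, Submodule.sum_mem _ fun i _ => Submodule.smul_mem _ _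
      (Submodule.subset_span ⟨i, rfl⟩), fun h0 => hc ?_, fun v hv => ?_⟩
    · exact funext (Fintype.linearIndependent_iff.mp he c h0)
    · induction hv using Submodule.span_induction with
      | mem x hx =>
        obtain ⟨j, rfl⟩ := hx
        have := congrFun hM j
        simp only [Matrix.mulVec, dotProduct, M, Matrix.of_apply, Pi.zero_apply] at this
        rw [Finset.sum_mul, map_sum, ← this]
        refine Finset.sum_congr rfl fun i _ => ?_
        rw [smul_mul_assoc, map_smul, smul_eq_mul, mul_comm, mul_comm (e i)]
      | zero => simp
      | add x y _ _ hx hy => rw [mul_add, map_add, hx, hy, add_zero]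
      | smul a x _ hx => rw [mul_smul_comm, map_smul, hx, smul_zero]
  by_cases h : (M t₂).det = 0
  · obtain ⟨w, hw⟩ := key t₂ h
    exact ⟨0, 1, by simp, w, by simpa using hw⟩
  -- The discriminant of the pencil is a cubic with leading coefficient `det (M t₂)`; a kernel
  -- vector at one of its roots spans part of the radical.
  have hdeg : (X • (M t₂).map C + (M t₁).map C).det.natDegree = 3 :=
    natDegree_eq_of_le_of_coeff_ne_zero (natDegree_det_X_add_C_le _ _)
      ((coeff_det_X_add_C_card (M t₂) (M t₁)).trans_ne h)
  obtain ⟨r, hr⟩ := hk _ (Or.inr (Or.inl hdeg))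
  have hr' : (M ((1 : k) • t₁ + r • t₂)).det = 0 := by
    rw [← hr, ← coe_evalRingHom, RingHom.map_det]
    congr 1
    ext i j
    simp [M, add_comm, mul_comm r]
  exact ⟨1, r, by simp, key _ hr'⟩

/-- A degenerate member of the pencil with radical vector `w` vanishes on the whole plane spanned by
`w` and any further zero `z`. On that plane the two forms are linearly dependent, so one quadratic
equation settles both. -/
theorem exists_common_zero_two_quadrics (hk : HasQuarticRoots k) (t₁ t₂ : R →ₗ[k] k)
    (W : Submodule k R) (hW : 3 ≤ Module.finrank k W) :
    ∃ u ∈ W, u ≠ 0 ∧ t₁ (u ^ 2) = 0 ∧ t₂ (u ^ 2) = 0 := by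
  obtain ⟨e₀, he₀⟩ := exists_linearIndependent_of_le_finrank hW
  set e : Fin 3 → R := fun i => (e₀ i : R)
  have he : LinearIndependent k e := he₀.map' W.subtype W.ker_subtype
  set U := Submodule.span k (Set.range e) with hU
  have hUW : U ≤ W := Submodule.span_le.mpr (by rintro _ ⟨i, rfl⟩; exact (e₀ i).2)
  have hU3 : 2 + 1 ≤ Module.finrank k U := by rw [hU, finrank_span_eq_card he]; simp
  obtain ⟨a, b, hab, w, hwU, hw0, hw⟩ := exists_degenerate_in_pencil hk t₁ t₂ he
  have line (V : Submodule k R) (hV : 2 ≤ Module.finrank k V) (t : R →ₗ[k] k) :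
      ∃ z ∈ V, z ≠ 0 ∧ t (z ^ 2) = 0 := by
    obtain ⟨x, hx, hx0⟩ := V.exists_mem_ne_zero_of_one_le_finrank (by omega)
    obtain ⟨l, hl⟩ := exists_functional_eq_one (k := k) hx0
    obtain ⟨y, hy, hy0⟩ := (V ⊓ LinearMap.ker l).exists_mem_ne_zero_of_one_le_finrank
      (le_finrank_inf_ker V l hV)
    obtain ⟨a, b, h⟩ := exists_zero_on_line hk t l hl hy.2 hy0 (Or.inl rfl)
    exact ⟨_, V.add_mem (V.smul_mem a hx) (V.smul_mem b hy.1), h⟩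
  obtain ⟨l, hl⟩ := exists_functional_eq_one (k := k) hw0
  obtain ⟨z, hz, hz0, hzq⟩ := line _ (le_finrank_inf_ker U l hU3) (a • t₁ + b • t₂)
  have hplane (c d : k) : (a • t₁ + b • t₂) ((c • w + d • z) ^ 2) = 0 := by
    have : (c • w + d • z) ^ 2 = c • (w * (c • w + d • z)) + (d * c) • (w * z)
        + (d ^ 2) • z ^ 2 := by
      simp only [Algebra.smul_def, map_mul, map_pow]
      ring
    rw [this, map_add, map_add, map_smul, map_smul, map_smul, hzq, hw z hz.1,
      hw _ (U.add_mem (U.smul_mem c hwU) (U.smul_mem d hz.1))]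
    simp
  have hmem (c d : k) : c • w + d • z ∈ W :=
    hUW (U.add_mem (U.smul_mem c hwU) (U.smul_mem d hz.1))
  by_cases ha : a = 0
  · have hb : b ≠ 0 := by simpa [ha] using hab
    obtain ⟨c, d, h0, h⟩ := exists_zero_on_line hk t₁ l hl hz.2 hz0 (Or.inl rfl)
    refine ⟨_, hmem c d, h0, h, ?_⟩
    simpa [ha, hb] using hplane c d
  · obtain ⟨c, d, h0, h⟩ := exists_zero_on_line hk t₂ l hl hz.2 hz0 (Or.inl rfl)
    refine ⟨_, hmem c d, h0, ?_, h⟩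
    simpa [ha, h] using hplane c d

/-- From a common zero `s` of the quadrics, a second one `z` is taken polar to `s` for both and
independent of it: three linear conditions, so 6 = 3 + 3. The line through them lies on both
quadrics, leaving a cubic in one unknown. -/
theorem exists_common_zero_two_quadrics_cubic (hk : HasQuarticRoots k) (t₁ t₂ t₃ : R →ₗ[k] k)
    (W : Submodule k R) (hW : 6 ≤ Module.finrank k W) :
    ∃ u ∈ W, u ≠ 0 ∧ t₁ (u ^ 2) = 0 ∧ t₂ (u ^ 2) = 0 ∧ t₃ (u ^ 3) = 0 := by
  obtain ⟨s, hs, hs0, hs1, hs2⟩ := exists_common_zero_two_quadrics hk t₁ t₂ W (by omega)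
  obtain ⟨l, hl⟩ := exists_functional_eq_one (k := k) hs0
  obtain ⟨z, ⟨⟨⟨hzW, hzl⟩, hz1⟩, hz2⟩, hz0, hzz1, hzz2⟩ :=
    exists_common_zero_two_quadrics hk t₁ t₂ _
    (le_finrank_inf_ker _ (t₂ ∘ₗ LinearMap.mulLeft k s)
      (le_finrank_inf_ker _ (t₁ ∘ₗ LinearMap.mulLeft k s) (le_finrank_inf_ker W l hW)))
  obtain ⟨a, b, h0, h⟩ := exists_zero_on_line hk t₃ l hl hzl hz0 (Or.inr (Or.inl rfl))
  have expand : (a • s + b • z) ^ 2 = (a ^ 2) • s ^ 2 + (2 * a * b) • (s * z)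
      + (b ^ 2) • z ^ 2 := by
    simp only [Algebra.smul_def, map_mul, map_pow, map_ofNat]
    ring
  have hz1' : t₁ (s * z) = 0 := hz1
  have hz2' : t₂ (s * z) = 0 := hz2
  refine ⟨_, W.add_mem (W.smul_mem a hs) (W.smul_mem b hzW), h0, ?_, ?_, h⟩
  · simp [expand, hs1, hz1', hzz1]
  · simp [expand, hs2, hz2', hzz2]

/-- On a space of dimension at least ten in a commutative algebra, a linear form and the quadratic,
cubic and quartic forms `u ↦ t (u ^ j)` have a common nontrivial zero. -/
theorem exists_common_zero_power_forms (hk : HasQuarticRoots k) (t : R →ₗ[k] k)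
    (W : Submodule k R) (hW : 10 ≤ Module.finrank k W) :
    ∃ u ∈ W, u ≠ 0 ∧ t u = 0 ∧ t (u ^ 2) = 0 ∧ t (u ^ 3) = 0 ∧ t (u ^ 4) = 0 := by
  have hV := le_finrank_inf_ker W t hW
  obtain ⟨p, ⟨hp, hp1⟩, hp0, hp2, -, hp3⟩ :=
    exists_common_zero_two_quadrics_cubic hk t t t (W ⊓ LinearMap.ker t) (by omega)
  obtain ⟨l, hl⟩ := exists_functional_eq_one (k := k) hp0
  -- All mixed terms of the square and the cube must vanish: `t (p z)` and `t (p² z)` are linear in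
  -- `z`, while `t (p z²)` is the second quadric. With `l` and `t` this costs four dimensions, and
  -- 10 = 4 + 6.
  obtain ⟨z, ⟨⟨⟨⟨hz, hz1⟩, hzl⟩, hpz⟩, hppz⟩, hz0, hz2, hpzz, hz3⟩ :=
    exists_common_zero_two_quadrics_cubic hk t (t ∘ₗ LinearMap.mulLeft k p) t _
    (le_finrank_inf_ker _ (t ∘ₗ LinearMap.mulLeft k (p ^ 2))
      (le_finrank_inf_ker _ (t ∘ₗ LinearMap.mulLeft k p) (le_finrank_inf_ker _ l hV)))
  obtain ⟨a, b, h0, h⟩ := exists_zero_on_line hk t l hl hzl hz0 (Or.inr (Or.inr rfl))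
  have hp1' : t p = 0 := hp1
  have hz1' : t z = 0 := hz1
  have hpz' : t (p * z) = 0 := hpz
  have hppz' : t (p ^ 2 * z) = 0 := hppz
  have hpzz' : t (p * z ^ 2) = 0 := hpzz
  have e2 : (a • p + b • z) ^ 2 = (a ^ 2) • p ^ 2 + (2 * a * b) • (p * z) + (b ^ 2) • z ^ 2 := by
    simp only [Algebra.smul_def, map_mul, map_pow, map_ofNat]
    ring
  have e3 : (a • p + b • z) ^ 3 = (a ^ 3) • p ^ 3 + (3 * a ^ 2 * b) • (p ^ 2 * z)
      + (3 * a * b ^ 2) • (p * z ^ 2) + (b ^ 3) • z ^ 3 := by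
    simp only [Algebra.smul_def, map_mul, map_pow, map_ofNat]
    ring
  refine ⟨_, W.add_mem (W.smul_mem a hp) (W.smul_mem b hz), h0, ?_, ?_, ?_, h⟩
  · simp [hp1', hz1']
  · simp [e2, hp2, hpz', hz2]
  · simp [e3, hp3, hppz', hpzz', hz3]

end PowerForms

/-! ### The general polynomial, its roots and their permutations. -/

/-- The field of rational functions in `n` variables, regarded as the field generated by the roots
of the general polynomial. -/
def RootField (k : Type*) [Field k] (n : ℕ) : Type _ :=
  FractionRing (MvPolynomial (Fin n) k)

namespace RootField

variable (k : Type*) [Field k] (n : ℕ)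

noncomputable instance : Field (RootField k n) :=
  inferInstanceAs (Field (FractionRing (MvPolynomial (Fin n) k)))

noncomputable instance : Algebra (MvPolynomial (Fin n) k) (RootField k n) :=
  inferInstanceAs (Algebra (MvPolynomial (Fin n) k) (FractionRing (MvPolynomial (Fin n) k)))

instance : IsFractionRing (MvPolynomial (Fin n) k) (RootField k n) :=
  inferInstanceAs (IsFractionRing (MvPolynomial (Fin n) k) (FractionRing (MvPolynomial (Fin n) k)))

/-- The coefficients of the general polynomial as polynomials in its roots. -/
noncomputable def coeffHom : MvPolynomial (Fin n) k →ₐ[k] MvPolynomial (Fin n) k :=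
  MvPolynomial.aeval fun i => (-1) ^ (i.val + 1) * MvPolynomial.esymm (Fin n) k (i.val + 1)

theorem coeffHom_injective : Function.Injective (coeffHom k n) := by
  -- The sign change is an involution; removing it leaves the algebraic independence of the
  -- elementary symmetric polynomials.
  let s : MvPolynomial (Fin n) k →ₐ[k] MvPolynomial (Fin n) k :=
    MvPolynomial.aeval fun i => (-1) ^ (i.val + 1) * MvPolynomial.X i
  have hs : s.comp s = AlgHom.id k _ := by
    refine MvPolynomial.algHom_ext fun i => ?_
    simp [s, ← mul_assoc, ← mul_pow]
  have hsi : Function.Injective s :=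
    Function.HasLeftInverse.injective ⟨s, fun x => by rw [← AlgHom.comp_apply, hs, AlgHom.id_apply]⟩
  have : ∀ x, coeffHom k n x = (MvPolynomial.esymmAlgHom (Fin n) k n (s x)).val := by
    intro x
    have hc : coeffHom k n = (MvPolynomial.aeval fun i : Fin n =>
        MvPolynomial.esymm (Fin n) k (i.val + 1)).comp s := by
      refine MvPolynomial.algHom_ext fun i => ?_
      simp only [coeffHom, s, AlgHom.comp_apply, MvPolynomial.aeval_X, map_mul, map_pow, map_neg,
        map_one]
    rw [MvPolynomial.esymmAlgHom_apply, hc, AlgHom.comp_apply]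
  intro x y h
  rw [this, this] at h
  exact hsi (MvPolynomial.esymmAlgHom_fin_injective k le_rfl (Subtype.ext h))

/-- Both fields have the same underlying type, but this embedding sends coefficients to signed
symmetric functions and is not the identity; hence the separate name `RootField`. -/
noncomputable instance : Algebra (CoeffField k n) (RootField k n) :=
  (IsFractionRing.lift (A := MvPolynomial (Fin n) k) (K := CoeffField k n) (L := RootField k n)
    (g := (algebraMap _ (RootField k n)).comp (coeffHom k n).toRingHom)
    ((IsFractionRing.injective _ _).comp (coeffHom_injective k n))).toAlgebra

theorem algebraMap_algebraMap (p : MvPolynomial (Fin n) k) :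
    algebraMap (CoeffField k n) (RootField k n) (algebraMap _ _ p)
      = algebraMap _ (RootField k n) (coeffHom k n p) :=
  IsFractionRing.lift_algebraMap _ _

/-- The `i`-th root of the general polynomial. -/
noncomputable def root (i : Fin n) : RootField k n :=
  algebraMap (MvPolynomial (Fin n) k) _ (MvPolynomial.X i)

theorem root_injective : Function.Injective (root k n) :=
  (IsFractionRing.injective _ _).comp MvPolynomial.X_injective

theorem map_generalPoly :
    (generalPoly k n).map (algebraMap _ (RootField k n)) = ∏ i, (X - C (root k n i)) := by
  have h := Multiset.prod_X_sub_X_eq_sum_esymm (Finset.univ.val.map (root k n))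
  rw [Multiset.map_map, Multiset.card_map, Finset.card_val, Finset.card_univ, Fintype.card_fin,
    Finset.sum_range_succ', Finset.sum_range] at h
  have h' : ∏ i, (X - C (root k n i))
    = (Finset.univ.val.map ((fun t => X - C t) ∘ root k n)).prod := rfl
  rw [h', h, generalPoly, add_comm]
  have he (j : ℕ) : (Finset.univ.val.map (root k n)).esymm j
      = algebraMap _ (RootField k n) (MvPolynomial.esymm (Fin n) k j) := by
    rw [← MvPolynomial.aeval_esymm_eq_multiset_esymm (Fin n) (MvPolynomial (Fin n) k)]
    simp [MvPolynomial.esymm, root, map_sum, map_prod]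
  simp only [Polynomial.map_add, Polynomial.map_sum, Polynomial.map_mul, Polynomial.map_pow, map_X,
    map_C, genCoeff, algebraMap_algebraMap, he]
  refine congrArg₂ (· + ·) (Finset.sum_congr rfl fun i _ => ?_) ?_
  · simp only [coeffHom, MvPolynomial.aeval_X, map_mul, map_pow, map_neg, map_one, mul_assoc]
  · simp

instance : Algebra.IsAlgebraic (CoeffField k n) (RootField k n) := by
  have hX (i : Fin n) : root k n i ∈ algebraicClosure (CoeffField k n) (RootField k n) := by
    rw [mem_algebraicClosure_iff]
    refine ⟨generalPoly k n, fun h => ?_, ?_⟩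
    · have := map_generalPoly k n
      rw [h, Polynomial.map_zero] at this
      exact (monic_prod_of_monic _ _ fun i _ => monic_X_sub_C (root k n i)).ne_zero this.symm
    · rw [aeval_def, ← eval_map, map_generalPoly, eval_prod]
      exact Finset.prod_eq_zero (Finset.mem_univ i) (by simp)
  have hp (p : MvPolynomial (Fin n) k) : algebraMap _ (RootField k n) p
      ∈ algebraicClosure (CoeffField k n) (RootField k n) := by
    induction p using MvPolynomial.induction_on with
    | C a =>
      have := algebraMap_algebraMap k n (MvPolynomial.C a)
      rw [coeffHom, ← MvPolynomial.algebraMap_eq, AlgHom.commutes] at this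
      rw [← MvPolynomial.algebraMap_eq, ← this]
      exact (algebraicClosure _ _).algebraMap_mem _
    | add p q hp hq => rw [map_add]; exact add_mem hp hq
    | mul_X p i hp => rw [map_mul]; exact mul_mem hp (hX i)
  refine ⟨fun x => mem_algebraicClosure_iff.mp ?_⟩
  obtain ⟨a, b, -, rfl⟩ := IsFractionRing.div_surjective (A := MvPolynomial (Fin n) k) x
  exact div_mem (hp a) (hp b)

/-- The action of a permutation of the roots. -/
noncomputable def permHom (σ : Equiv.Perm (Fin n)) : RootField k n →+* RootField k n :=
  IsFractionRing.lift (A := MvPolynomial (Fin n) k)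
    (g := (algebraMap (MvPolynomial (Fin n) k) (RootField k n)).comp
      (MvPolynomial.rename σ : _ →ₐ[k] _).toRingHom)
    ((IsFractionRing.injective _ _).comp (MvPolynomial.rename_injective σ σ.injective))

theorem permHom_algebraMap (σ : Equiv.Perm (Fin n)) (p : MvPolynomial (Fin n) k) :
    permHom k n σ (algebraMap _ _ p) = algebraMap _ _ (MvPolynomial.rename σ p) :=
  IsFractionRing.lift_algebraMap _ _

theorem exists_algEquiv (σ : Equiv.Perm (Fin n)) :
    ∃ g : RootField k n ≃ₐ[CoeffField k n] RootField k n, ∀ i, g (root k n i) = root k n (σ i) := by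
  have hc (p : MvPolynomial (Fin n) k) :
      MvPolynomial.rename σ (coeffHom k n p) = coeffHom k n p := by
    have : (MvPolynomial.rename σ).comp (coeffHom k n) = coeffHom k n := by
      refine MvPolynomial.algHom_ext fun i => ?_
      simp only [coeffHom, AlgHom.comp_apply, MvPolynomial.aeval_X, map_mul, map_pow, map_neg,
        map_one, MvPolynomial.rename_esymm]
    rw [← AlgHom.comp_apply, this]
  let f : RootField k n →ₐ[CoeffField k n] RootField k n :=
    { permHom k n σ with
      commutes' := fun x => by
        obtain ⟨a, b, -, rfl⟩ := IsFractionRing.div_surjective (A := MvPolynomial (Fin n) k) x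
        change permHom k n σ _ = _
        simp only [map_div₀, algebraMap_algebraMap, permHom_algebraMap, hc] }
  refine ⟨AlgEquiv.ofBijective f (Algebra.IsAlgebraic.algHom_bijective f), fun i => ?_⟩
  exact (permHom_algebraMap k n σ _).trans (by rw [MvPolynomial.rename_X]; rfl)

end RootField

/-- The Galois group of the general polynomial is the full symmetric group. -/
theorem exists_roots_generalPoly (k : Type*) [Field k] (n : ℕ) :
    ∃ x : Fin n → AlgebraicClosure (CoeffField k n), Function.Injective x ∧
      (generalPoly k n).map (algebraMap _ _) = ∏ i, (X - C (x i)) ∧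
      ∀ σ : Equiv.Perm (Fin n), ∃ g : AlgebraicClosure (CoeffField k n) ≃ₐ[CoeffField k n]
        AlgebraicClosure (CoeffField k n), ∀ i, g (x i) = x (σ i) := by
  let φ : RootField k n →ₐ[CoeffField k n] AlgebraicClosure (CoeffField k n) := IsAlgClosed.lift
  refine ⟨φ ∘ RootField.root k n, φ.toRingHom.injective.comp (RootField.root_injective k n), ?_, ?_⟩
  · rw [← φ.comp_algebraMap, ← Polynomial.map_map, RootField.map_generalPoly, Polynomial.map_prod]
    simp
  · intro σ
    obtain ⟨g, hg⟩ := RootField.exists_algEquiv k n σ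
    let : Algebra (RootField k n) (AlgebraicClosure (CoeffField k n)) := φ.toRingHom.toAlgebra
    have : IsScalarTower (CoeffField k n) (RootField k n) (AlgebraicClosure (CoeffField k n)) :=
      IsScalarTower.of_algebraMap_eq fun x => (φ.commutes x).symm
    refine ⟨g.liftNormal _, fun i => ?_⟩
    have := g.liftNormal_commutes (AlgebraicClosure (CoeffField k n)) (RootField.root k n i)
    rw [hg] at this
    exact this

/-! ### Towers of degree at most four and the automorphisms that survive them. -/

section Towers

variable {K L : Type*} [Field K] [Field L] [Algebra K L]

theorem IsQuarticTower.exists_ge_ge {F F' : IntermediateField K L} (hF : IsQuarticTower F)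
    (hF' : IsQuarticTower F') : ∃ G : IntermediateField K L, IsQuarticTower G ∧ F ≤ G ∧ F' ≤ G := by
  -- The second tower is replayed on top of the first.
  induction hF' with
  | base => exact ⟨F, hF, le_rfl, bot_le⟩
  | step F' p θ _ hdeg hroot ih =>
    obtain ⟨G, hG, hFG, hF'G⟩ := ih
    refine ⟨_, hG.step G (p.map (inclusion hF'G).toRingHom) θ (by rwa [natDegree_map]) ?_, ?_, ?_⟩
    · rw [aeval_def, eval₂_map]
      exact hroot
    · intro z hz
      exact (G⟮θ⟯).algebraMap_mem ⟨z, hFG hz⟩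
    · rw [restrictScalars_adjoin, restrictScalars_adjoin]
      exact adjoin.mono _ _ _ (Set.union_subset_union_left _ hF'G)

variable (K L) in
/-- The union of all towers of extensions of degree at most four. -/
def quarticClosure : IntermediateField K L :=
  ⨆ F : {F : IntermediateField K L // IsQuarticTower F}, F.1

theorem directed_isQuarticTower : Directed (· ≤ ·)
    (fun F : {F : IntermediateField K L // IsQuarticTower F} => F.1) := fun F F' => by
  obtain ⟨G, hG, h⟩ := F.2.exists_ge_ge F'.2
  exact ⟨⟨G, hG⟩, h⟩

instance : Nonempty {F : IntermediateField K L // IsQuarticTower F} := ⟨⟨⊥, .base⟩⟩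

theorem mem_quarticClosure {z : L} :
    z ∈ quarticClosure K L ↔ ∃ F : IntermediateField K L, IsQuarticTower F ∧ z ∈ F := by
  rw [quarticClosure, ← SetLike.mem_coe, coe_iSup_of_directed directed_isQuarticTower]
  simp

theorem exists_isQuarticTower_of_finite {ι : Type*} [Finite ι] (a : ι → L)
    (ha : ∀ i, a i ∈ quarticClosure K L) :
    ∃ F : IntermediateField K L, IsQuarticTower F ∧ ∀ i, a i ∈ F := by
  choose F hF haF using fun i => mem_quarticClosure.mp (ha i)
  obtain ⟨G, hG⟩ := directed_isQuarticTower.finite_le fun i => ⟨F i, hF i⟩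
  exact ⟨G.1, G.2, fun i => hG i (haF i)⟩

theorem exists_map_eq_map (u : (quarticClosure K L)[X]) :
    ∃ F : IntermediateField K L, IsQuarticTower F ∧ ∃ v : F[X], v.map (algebraMap F L) = u.map (algebraMap _ L) := by
  obtain ⟨F, hF, hcoeff⟩ := exists_isQuarticTower_of_finite
    (fun i : Fin (u.natDegree + 1) => (u.coeff i : L)) fun i => (u.coeff i).2
  refine ⟨F, hF, ?_⟩
  rw [← mem_lifts, lifts_iff_coeff_lifts]
  intro i
  rw [coeff_map]
  by_cases hi : i < u.natDegree + 1
  · exact ⟨⟨_, hcoeff ⟨i, hi⟩⟩, rfl⟩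
  · exact ⟨0, by rw [coeff_eq_zero_of_natDegree_lt (by omega), map_zero, map_zero]⟩

theorem hasQuarticRoots_quarticClosure [IsAlgClosed L] :
    HasQuarticRoots (quarticClosure K L) := by
  intro p hp
  obtain ⟨F, hF, q, hq⟩ := exists_map_eq_map p
  have hdeg : q.natDegree = p.natDegree := by
    rw [← natDegree_map (algebraMap F L), hq, natDegree_map]
  obtain ⟨θ, hθ⟩ := IsAlgClosed.exists_root (p.map (algebraMap _ L)) (by
    rw [degree_map]
    intro h
    have : p.natDegree = 0 := natDegree_eq_of_degree_eq_some h
    omega)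
  have hθF := hF.step F q θ (by rwa [hdeg]) (by
    rw [aeval_def, ← eval_map, hq]
    exact hθ)
  refine ⟨⟨θ, mem_quarticClosure.mpr ⟨_, hθF, mem_adjoin_simple_self F θ⟩⟩, ?_⟩
  apply (algebraMap (quarticClosure K L) L).injective
  rw [map_zero, ← eval₂_at_apply, ← eval_map]
  exact hθ

theorem AlgEquiv.pow_apply_of_apply {ι : Type*} {x : ι → L} {σ : Equiv.Perm ι} {g : L ≃ₐ[K] L}
    (h : ∀ i, g (x i) = x (σ i)) (m : ℕ) (i : ι) : (g ^ m) (x i) = x ((σ ^ m) i) := by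
  induction m generalizing i with
  | zero => rfl
  | succ m ih => rw [pow_succ, pow_succ, AlgEquiv.mul_apply, h, ih, Equiv.Perm.mul_apply]

theorem AlgEquiv.pow_apply_of_fixed {g : L ≃ₐ[K] L} {z : L} (h : g z = z) (m : ℕ) :
    (g ^ m) z = z :=
  AlgEquiv.pow_apply_of_apply (x := fun _ : Unit => z) (σ := 1) (fun _ => h) m ()

theorem AlgEquiv.apply_aeval_of_fixed {F : IntermediateField K L} {g : L ≃ₐ[K] L}
    (hg : ∀ z ∈ F, g z = z) (p : F[X]) (z : L) : g (aeval z p) = aeval (g z) p := by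
  rw [aeval_eq_sum_range, aeval_eq_sum_range, map_sum]
  refine Finset.sum_congr rfl fun i _ => ?_
  rw [Algebra.smul_def, Algebra.smul_def, map_mul, map_pow]
  exact congrArg (· * _) (hg _ (p.coeff i).2)

/-- If `g` fixes the coefficients of a polynomial of degree at most four, then every power of `g`
whose exponent is a multiple of `4!` fixes its roots. -/
theorem AlgEquiv.pow_apply_root {F : IntermediateField K L} {p : F[X]} (hp : p ≠ 0)
    (hdeg : p.natDegree ≤ 4) {g : L ≃ₐ[K] L} (hg : ∀ z ∈ F, g z = z) {θ : L} (hθ : aeval θ p = 0)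
    {m : ℕ} (hm : 24 ∣ m) : (g ^ m) θ = θ := by
  have hS (z : L) : g.toEquiv z ∈ p.rootSet L ↔ z ∈ p.rootSet L := by
    rw [mem_rootSet_of_ne hp, mem_rootSet_of_ne hp]
    change aeval (g z) p = 0 ↔ aeval z p = 0
    rw [← AlgEquiv.apply_aeval_of_fixed hg, map_eq_zero_iff _ g.injective]
  let s : Equiv.Perm (p.rootSet L) := Equiv.Perm.subtypePerm g.toEquiv hS
  have hs : s ^ m = 1 := by
    -- `s` permutes at most four roots, so its order divides 4! = 24.
    refine orderOf_dvd_iff_pow_eq_one.mp (((orderOf_dvd_natCard s).trans ?_).trans hm)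
    rw [Nat.card_perm]
    refine Nat.factorial_dvd_factorial (n := 4) ((?_ : Nat.card (p.rootSet L) ≤ _).trans hdeg)
    exact p.ncard_rootSet_le L
  have key (j : ℕ) (z : p.rootSet L) : (g ^ j) (z : L) = ((s ^ j) z : p.rootSet L) :=
    AlgEquiv.pow_apply_of_apply (x := Subtype.val) (σ := s) (g := g) (fun _ => rfl) j z
  have := key m ⟨θ, (mem_rootSet_of_ne hp).mpr hθ⟩
  rwa [hs] at this

/-- Adjoining roots of polynomials of degree at most four does not destroy automorphisms that
permute a given family by a permutation of order five. -/
theorem IsQuarticTower.exists_algEquiv {F : IntermediateField K L} (hF : IsQuarticTower F)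
    {ι : Type*} {x : ι → L} {σ : Equiv.Perm ι} (hσ : σ ^ 5 = 1)
    (h : ∃ g : L ≃ₐ[K] L, ∀ i, g (x i) = x (σ i)) :
    ∃ g : L ≃ₐ[K] L, (∀ z ∈ F, g z = z) ∧ ∀ i, g (x i) = x (σ i) := by
  induction hF with
  | base =>
    obtain ⟨g, hg⟩ := h
    refine ⟨g, fun z hz => ?_, hg⟩
    obtain ⟨c, rfl⟩ := mem_bot.mp hz
    exact g.commutes c
  | step F p θ _ hdeg hroot ih =>
    obtain ⟨g, hgF, hgx⟩ := ih
    have hp : p ≠ 0 := by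
      rintro rfl
      simp at hdeg
    -- Since 96 is 0 modulo 24 and 1 modulo 5, `g ^ 96` fixes `θ` and still acts on the family as
    -- `σ`.
    obtain ⟨m, hm, l, hl⟩ : ∃ m, 24 ∣ m ∧ ∃ l, m = 5 * l + 1 := ⟨96, by norm_num, 19, rfl⟩
    refine ⟨g ^ m, fun z hz => ?_, fun i => ?_⟩
    · replace hz : z ∈ F⟮θ⟯ := hz
      induction hz using adjoin_induction with
      | mem z hz =>
        rw [Set.mem_singleton_iff.mp hz]
        exact AlgEquiv.pow_apply_root hp (by omega) hgF hroot hm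
      | algebraMap c => exact AlgEquiv.pow_apply_of_fixed (hgF _ c.2) m
      | add a b ha hb iha ihb => rw [map_add, iha, ihb]
      | mul a b ha hb iha ihb => rw [map_mul, iha, ihb]
      | inv a ha iha => rw [map_inv₀, iha]
    · rw [AlgEquiv.pow_apply_of_apply hgx, hl, pow_add, pow_mul, hσ, one_pow, one_mul, pow_one]

theorem IntermediateField.mem_of_forall_algEquiv [IsGalois K L] (F : IntermediateField K L) {z : L}
    (h : ∀ g : L ≃ₐ[K] L, (∀ c ∈ F, g c = c) → g z = z) : z ∈ F := by
  have : z ∈ (⊥ : IntermediateField F L) := by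
    rw [InfiniteGalois.mem_bot_iff_fixed]
    exact fun g => h (g.restrictScalars K) fun c hc => g.commutes ⟨c, hc⟩
  obtain ⟨c, rfl⟩ := mem_bot.mp this
  exact c.2

end Towers

/-! ### Five-cycles, Newton's identities and evaluation. -/

theorem Equiv.Perm.exists_pow_five_eq_one {n : ℕ} (hn : 5 ≤ n) {i j k : Fin n} (hij : i ≠ j)
    (hki : k ≠ i) (hkj : k ≠ j) : ∃ σ : Equiv.Perm (Fin n), σ ^ 5 = 1 ∧ σ i = j ∧ σ j = k := by
  have hex (s : Finset (Fin n)) (hs : s.card < 5) : ∃ l, l ∉ s := by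
    by_contra! h
    have := Finset.eq_univ_iff_forall.mpr h
    rw [this, Finset.card_univ, Fintype.card_fin] at hs
    omega
  obtain ⟨l, hl⟩ := hex {i, j, k} (Finset.card_le_three.trans_lt (by norm_num))
  obtain ⟨m, hm⟩ := hex {i, j, k, l} (Finset.card_le_four.trans_lt (by norm_num))
  simp only [Finset.mem_insert, Finset.mem_singleton, not_or] at hl hm
  have hnd : [i, j, k, l, m].Nodup := by
    simp [hij, hki.symm, hkj.symm, Ne.symm hl.1, Ne.symm hl.2.1, Ne.symm hl.2.2, Ne.symm hm.1,
      Ne.symm hm.2.1, Ne.symm hm.2.2.1, Ne.symm hm.2.2.2]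
  exact ⟨[i, j, k, l, m].formPerm, List.formPerm_pow_length_eq_one_of_nodup _ hnd,
    List.formPerm_apply_lt_getElem _ hnd 0 (by simp),
    List.formPerm_apply_lt_getElem _ hnd 1 (by simp)⟩

theorem Multiset.esymm_eq_zero_of_psum_eq_zero {L : Type*} [Field L] [CharZero L] {n : ℕ}
    (y : Fin n → L) {d : ℕ} (h : ∀ m, 1 ≤ m → m ≤ d → ∑ i, y i ^ m = 0) {m : ℕ} (hm : 1 ≤ m)
    (hmd : m ≤ d) : (Finset.univ.val.map y).esymm m = 0 := by
  have := congrArg (MvPolynomial.aeval y) (MvPolynomial.mul_esymm_eq_sum (Fin n) ℤ m)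
  rw [map_mul, map_mul, map_sum, Finset.sum_eq_zero, mul_zero, map_natCast,
    MvPolynomial.aeval_esymm_eq_multiset_esymm] at this
  · exact (mul_eq_zero.mp this).resolve_left (by exact_mod_cast (by omega : m ≠ 0))
  · intro a ha
    rw [Finset.mem_filter, Finset.HasAntidiagonal.mem_antidiagonal] at ha
    have : MvPolynomial.aeval y (MvPolynomial.psum (Fin n) ℤ a.2) = 0 := by
      simpa [MvPolynomial.psum] using h a.2 (by omega) (by omega)
    rw [map_mul, this, mul_zero]

theorem tschirnhausValue_coeff {L : Type*} [Field L] {n : ℕ} {p : L[X]} (hp : p.degree < n)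
    (z : L) : tschirnhausValue (fun j : Fin n => p.coeff j) z = p.eval z :=
  (eval_eq_sum_degreeLTEquiv (mem_degreeLT.mpr hp) z).symm

theorem tschirnhausValue_coeff_intermediateField {K L : Type*} [Field K] [Field L] [Algebra K L]
    {F : IntermediateField K L} {n : ℕ} {u : F[X]} (hu : u.degree < n) (z : L) :
    tschirnhausValue (fun j : Fin n => (u.coeff j : L)) z = aeval z u := by
  have h : (u.map (algebraMap F L)).degree < n := by rwa [degree_map]
  rw [aeval_def, ← eval_map, ← tschirnhausValue_coeff h]
  simp only [coeff_map]
  rfl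

/-! ### Construction and inversion of the transformation. -/

section RootFamily

variable {K L : Type*} [Field K] [Field L] [Algebra K L] {n : ℕ} {f : K[X]} {x : Fin n → L}

theorem exists_perm_of_map_eq_prod (hx : Function.Injective x)
    (hf : f.map (algebraMap K L) = ∏ i, (X - C (x i))) (g : L ≃ₐ[K] L) :
    ∃ τ : Equiv.Perm (Fin n), ∀ i, g (x i) = x (τ i) := by
  have hroot (i : Fin n) : ∃ j, g (x i) = x j := by
    have h0 : aeval (x i) f = 0 := by
      rw [aeval_def, ← eval_map, hf, eval_prod]
      exact Finset.prod_eq_zero (Finset.mem_univ i) (by simp)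
    have h1 : aeval (g (x i)) f = 0 := by rw [aeval_algHom_apply, h0, map_zero]
    rw [aeval_def, ← eval_map, hf, eval_prod, Finset.prod_eq_zero_iff] at h1
    obtain ⟨j, -, hj⟩ := h1
    exact ⟨j, by simpa [sub_eq_zero] using hj⟩
  choose τ hτ using hroot
  have hinj : Function.Injective τ := fun i j hij => hx (g.injective (by rw [hτ, hτ, hij]))
  exact ⟨Equiv.ofBijective τ (Finite.injective_iff_bijective.mp hinj), hτ⟩

theorem aroots_eq_of_map_eq_prod (hf : f.map (algebraMap K L) = ∏ i, (X - C (x i))) :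
    f.aroots L = Finset.univ.val.map x := by
  rw [aroots_def, hf, ← roots_multiset_prod_X_sub_C (Finset.univ.val.map x), Multiset.map_map]
  rfl

/-- A nonzero polynomial of degree less than `n` over a tower, the sum of whose values at the roots
is zero, takes distinct values at the roots. -/
theorem injective_aeval_of_sum_eq_zero [CharZero L] (hn : 5 ≤ n) (hx : Function.Injective x)
    (hσ : ∀ σ : Equiv.Perm (Fin n), ∃ g : L ≃ₐ[K] L, ∀ i, g (x i) = x (σ i))
    {F : IntermediateField K L} (hF : IsQuarticTower F) {u : F[X]} (hu0 : u ≠ 0)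
    (hu : u.degree < n) (hsum : ∑ i, aeval (x i) u = 0) :
    Function.Injective fun i => aeval (x i) u := by
  intro i j hij
  by_contra hne
  have hall (k : Fin n) : aeval (x k) u = aeval (x j) u := by
    by_cases hki : k = i
    · rw [hki]; exact hij
    by_cases hkj : k = j
    · rw [hkj]
    -- Sending `i` to `j` and `j` to `k` turns the equality of values at `i`, `j` into one at `j`,
    -- `k`.
    obtain ⟨σ, hσ5, hσi, hσj⟩ := Equiv.Perm.exists_pow_five_eq_one hn hne hki hkj
    obtain ⟨g, hgF, hgx⟩ := hF.exists_algEquiv hσ5 (hσ σ)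
    have hg (l : Fin n) : g (aeval (x l) u) = aeval (x (σ l)) u := by
      rw [AlgEquiv.apply_aeval_of_fixed hgF, hgx]
    have h := congrArg g hij
    simp only [hg, hσi, hσj] at h
    exact h.symm
  have hzero (k : Fin n) : aeval (x k) u = 0 := by
    rw [hall k]
    simpa [hall, show n ≠ 0 by omega] using hsum
  refine hu0 (Polynomial.map_injective (algebraMap F L) (algebraMap F L).injective ?_)
  rw [Polynomial.map_zero]
  refine eq_zero_of_degree_lt_of_eval_index_eq_zero (s := Finset.univ) (v := x) hx.injOn ?_
    fun k _ => ?_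
  · rwa [degree_map, Finset.card_univ, Fintype.card_fin]
  · rw [eval_map, ← aeval_def, hzero]

variable [IsGalois K L]

theorem sum_pow_mem (hx : Function.Injective x)
    (hf : f.map (algebraMap K L) = ∏ i, (X - C (x i))) (F : IntermediateField K L) (m : ℕ) :
    ∑ i, x i ^ m ∈ F := by
  refine F.mem_of_forall_algEquiv fun g _ => ?_
  obtain ⟨τ, hτ⟩ := exists_perm_of_map_eq_prod hx hf g
  simp only [map_sum, map_pow, hτ]
  exact Equiv.sum_comp τ fun i => x i ^ m

/-- The sum of the values of a polynomial at the roots, as a linear form. -/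
theorem exists_sum_aeval_linearForm (hx : Function.Injective x)
    (hf : f.map (algebraMap K L) = ∏ i, (X - C (x i))) (F : IntermediateField K L) :
    ∃ t : F[X] →ₗ[F] F, ∀ A, (t A : L) = ∑ i, aeval (x i) A := by
  -- The sums lie in `F` by Galois invariance; an `F`-linear retraction `π` of `L` onto `F` makes
  -- the form `F`-valued.
  obtain ⟨π, hπ⟩ := (Algebra.linearMap F L).exists_leftInverse_of_injective
    (LinearMap.ker_eq_bot.mpr (algebraMap F L).injective)
  refine ⟨π ∘ₗ ∑ i, (aeval (x i) : F[X] →ₐ[F] L).toLinearMap, fun A => ?_⟩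
  have hmem : ∑ i, aeval (x i) A ∈ F := by
    simp only [aeval_eq_sum_range]
    rw [Finset.sum_comm]
    refine sum_mem fun m _ => ?_
    rw [← Finset.smul_sum]
    exact F.mul_mem (A.coeff m).2 (sum_pow_mem hx hf F m)
  have := LinearMap.congr_fun hπ ⟨_, hmem⟩
  simp only [LinearMap.comp_apply, LinearMap.sum_apply, AlgHom.toLinearMap_apply]
  exact congrArg Subtype.val this

/-- A transformation that separates the roots is invertible. -/
theorem exists_inverse_transform (hx : Function.Injective x)
    (hf : f.map (algebraMap K L) = ∏ i, (X - C (x i))) (F : IntermediateField K L) {u : F[X]}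
    (hu : Function.Injective fun i => aeval (x i) u) :
    ∃ b : Fin n → F, ∀ i, tschirnhausValue (fun j => (b j : L)) (aeval (x i) u) = x i := by
  set y : Fin n → L := fun i => aeval (x i) u with hy
  set p := Lagrange.interpolate Finset.univ y x with hp
  obtain ⟨hdeg, heval⟩ := (Lagrange.eq_interpolate_iff x hu.injOn).mpr hp
  have hmem (m : ℕ) : p.coeff m ∈ F := by
    refine F.mem_of_forall_algEquiv fun g hg => ?_
    obtain ⟨τ, hτ⟩ := exists_perm_of_map_eq_prod hx hf g
    have hgy (i : Fin n) : g (y i) = y (τ i) := by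
      rw [hy, AlgEquiv.apply_aeval_of_fixed hg, hτ]
    -- `g` permutes the nodes and the values in the same way, so uniqueness of interpolation forces
    -- it to fix `p`.
    have : p.map (g : L →+* L) = p := by
      refine (Lagrange.eq_interpolate_iff x hu.injOn).mp ⟨by rwa [degree_map], fun i _ => ?_⟩
      obtain ⟨j, rfl⟩ := τ.surjective i
      have := eval_map_apply (f := (g : L →+* L)) (p := p) (y j)
      rw [heval j (Finset.mem_univ j)] at this
      rw [← hgy, ← hτ]
      exact this
    conv_rhs => rw [← this]
    rw [coeff_map]
    rfl
  refine ⟨fun j => ⟨p.coeff j, hmem j⟩, fun i => ?_⟩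
  rw [Finset.card_univ, Fintype.card_fin] at hdeg
  exact (tschirnhausValue_coeff hdeg _).trans (heval i (Finset.mem_univ i))

theorem esymm_aeval_mem (hx : Function.Injective x)
    (hf : f.map (algebraMap K L) = ∏ i, (X - C (x i))) (F : IntermediateField K L) (u : F[X])
    (m : ℕ) : (Finset.univ.val.map fun i => aeval (x i) u).esymm m ∈ F := by
  refine F.mem_of_forall_algEquiv fun g hg => ?_
  obtain ⟨τ, hτ⟩ := exists_perm_of_map_eq_prod hx hf g
  set y : Fin n → L := fun i => aeval (x i) u with hy
  have hgy (i : Fin n) : g (y i) = y (τ i) := by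
    rw [hy, AlgEquiv.apply_aeval_of_fixed hg, hτ]
  rw [← MvPolynomial.aeval_esymm_eq_multiset_esymm (Fin n) K]
  conv_rhs => rw [← MvPolynomial.rename_esymm (Fin n) K m τ, MvPolynomial.aeval_rename]
  have := MvPolynomial.comp_aeval_apply (R := K) (f := y) (g : L →ₐ[K] L)
    (MvPolynomial.esymm (Fin n) K m)
  refine this.trans ?_
  congr 2
  exact funext hgy

theorem tschirnhausTransform_eq [CharZero L] (hn : 4 ≤ n) (hx : Function.Injective x)
    (hf : f.map (algebraMap K L) = ∏ i, (X - C (x i))) (F : IntermediateField K L) {u : F[X]}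
    (hu : u.degree < n) (hpow : ∀ m, 1 ≤ m → m ≤ 4 → ∑ i, aeval (x i) u ^ m = 0) :
    ∃ D : ℕ → F, tschirnhausTransform f (fun j : Fin n => (u.coeff j : L)) =
      X ^ n + ∑ i ∈ Finset.Icc 5 n, C (D i : L) * X ^ (n - i) := by
  set y : Fin n → L := fun i => aeval (x i) u with hy
  refine ⟨fun m => ⟨(-1) ^ m * (Finset.univ.val.map y).esymm m,
    F.mul_mem (pow_mem (neg_mem (one_mem F)) m) (esymm_aeval_mem hx hf F u m)⟩, ?_⟩
  have hprod : tschirnhausTransform f (fun j : Fin n => (u.coeff j : L))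
      = ((Finset.univ.val.map y).map fun t => X - C t).prod := by
    rw [tschirnhausTransform, aroots_eq_of_map_eq_prod hf, Multiset.map_map, Multiset.map_map]
    simp only [Function.comp_def, tschirnhausValue_coeff_intermediateField hu, hy]
  have hsplit : Finset.range (n + 1) = insert 0 (Finset.Icc 1 4 ∪ Finset.Icc 5 n) := by
    ext i
    simp only [Finset.mem_range, Finset.mem_insert, Finset.mem_union, Finset.mem_Icc]
    omega
  have hdisj : Disjoint (Finset.Icc 1 4) (Finset.Icc 5 n) :=
    Finset.disjoint_left.mpr fun i hi hi' => by
      rw [Finset.mem_Icc] at hi hi'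
      omega
  rw [hprod, Multiset.prod_X_sub_X_eq_sum_esymm, Multiset.card_map, Finset.card_val,
    Finset.card_univ, Fintype.card_fin, hsplit, Finset.sum_insert (by simp),
    Finset.sum_union hdisj, Finset.sum_eq_zero (s := Finset.Icc 1 4), zero_add]
  · have h0 : (Finset.univ.val.map y).esymm 0 = 1 := by
      rw [Multiset.esymm, Multiset.powersetCard_zero_left]
      simp
    refine congrArg₂ (· + ·) (by rw [h0]; simp) (Finset.sum_congr rfl fun i _ => ?_)
    simp [mul_assoc]
  · intro i hi
    rw [Finset.mem_Icc] at hi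
    rw [Multiset.esymm_eq_zero_of_psum_eq_zero y hpow hi.1 hi.2]
    simp

theorem finrank_degreeLT (k : Type*) [Field k] (n : ℕ) : Module.finrank k (degreeLT k n) = n := by
  rw [(degreeLTEquiv k n).finrank_eq, Module.finrank_fin_fun]

/-- The transformation exists for every equation whose Galois group is the full symmetric group. -/
theorem exists_tschirnhaus [CharZero L] [IsAlgClosed L] (hn : 10 ≤ n) (hx : Function.Injective x)
    (hf : f.map (algebraMap K L) = ∏ i, (X - C (x i)))
    (hσ : ∀ σ : Equiv.Perm (Fin n), ∃ g : L ≃ₐ[K] L, ∀ i, g (x i) = x (σ i)) :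
    ∃ F : IntermediateField K L, IsQuarticTower F ∧ ∃ a : Fin n → F,
      (∃ D : ℕ → F, tschirnhausTransform f (fun j => (a j : L)) =
        X ^ n + ∑ i ∈ Finset.Icc 5 n, C (D i : L) * X ^ (n - i)) ∧
      (∃ b : Fin n → F, ∀ z ∈ f.rootSet L, tschirnhausValue (fun j => (b j : L))
        (tschirnhausValue (fun j => (a j : L)) z) = z) := by
  obtain ⟨t, ht⟩ := exists_sum_aeval_linearForm hx hf (quarticClosure K L)
  obtain ⟨u, hu, hu0, ht1, ht2, ht3, ht4⟩ := exists_common_zero_power_forms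
    hasQuarticRoots_quarticClosure t (degreeLT _ n) (by rwa [finrank_degreeLT])
  -- Descent from the infinite union to a single finite tower.
  obtain ⟨F, hF, v, hv⟩ := exists_map_eq_map u
  have hvu (z : L) : aeval z v = aeval z u := by
    rw [aeval_def, ← eval_map, hv, eval_map, ← aeval_def]
  have hv0 : v ≠ 0 := by
    rintro rfl
    rw [Polynomial.map_zero] at hv
    exact hu0 ((Polynomial.map_eq_zero _).mp hv.symm)
  have hdeg : v.degree < n := by
    rw [← degree_map v (algebraMap F L), hv, degree_map]
    exact mem_degreeLT.mp hu
  have hpow (m : ℕ) (h1 : 1 ≤ m) (h4 : m ≤ 4) : ∑ i, aeval (x i) v ^ m = 0 := by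
    have h0 : t (u ^ m) = 0 := by
      obtain rfl | rfl | rfl | rfl : m = 1 ∨ m = 2 ∨ m = 3 ∨ m = 4 := by omega
      · rwa [pow_one]
      · exact ht2
      · exact ht3
      · exact ht4
    have h := ht (u ^ m)
    rw [h0, ZeroMemClass.coe_zero] at h
    refine (Finset.sum_congr rfl fun i _ => ?_).trans h.symm
    rw [hvu, map_pow]
  have hinj := injective_aeval_of_sum_eq_zero (by omega) hx hσ hF hv0 hdeg
    (by simpa using hpow 1 le_rfl (by norm_num))
  obtain ⟨b, hb⟩ := exists_inverse_transform hx hf F hinj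
  refine ⟨F, hF, fun j => v.coeff j, tschirnhausTransform_eq (by omega) hx hf F hdeg hpow, b, ?_⟩
  intro z hz
  classical
  rw [rootSet_def, Finset.mem_coe, Multiset.mem_toFinset, aroots_eq_of_map_eq_prod hf,
    Multiset.mem_map] at hz
  obtain ⟨i, -, rfl⟩ := hz
  rw [tschirnhausValue_coeff_intermediateField hdeg, hb]

end RootFamily

theorem mainTheorem1 (k : Type*) [Field k] [CharZero k] (n : ℕ) (hn : 10 ≤ n) :
    ∃ F : IntermediateField (CoeffField k n) (AlgebraicClosure (CoeffField k n)),
      IsQuarticTower F ∧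
      ∃ a : Fin n → F,
        (∃ D : ℕ → F,
          tschirnhausTransform (generalPoly k n)
              (fun j => (a j : AlgebraicClosure (CoeffField k n))) =
            X ^ n + ∑ i ∈ Finset.Icc 5 n,
              C (D i : AlgebraicClosure (CoeffField k n)) * X ^ (n - i)) ∧
        (∃ b : Fin n → F,
          ∀ x ∈ (generalPoly k n).rootSet (AlgebraicClosure (CoeffField k n)),
            tschirnhausValue (fun j => (b j : AlgebraicClosure (CoeffField k n)))
              (tschirnhausValue (fun j => (a j : AlgebraicClosure (CoeffField k n))) x) = x) := by
  obtain ⟨x, hx, hf, hσ⟩ := exists_roots_generalPoly k n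
  have : CharZero (AlgebraicClosure (CoeffField k n)) :=
    charZero_of_injective_algebraMap (algebraMap (CoeffField k n) _).injective
  exact exists_tschirnhaus hn hx hf hσ
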